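/- Call a complex-valued function $f(t,z)$ of a real variable $t$ and a complex variable $z$ \emph{analytic} on an open set $A\subseteq\mathbb R\times\mathbb C$ if around every point $(t_0,z_0)\in A$ it is given by a convergent power series in $t-t_0$ and $z-z_0$ with complex coefficients. Let $A$ be a connected open subset of $\mathbb R\times\mathbb C$ containing the point $(0,p)$, and let $f:A\to\mathbb C$ be analytic. Suppose that $f(0,p)=0$ and that for each sufficiently small $t>0$ the function $f(t,\cdot)$ is not constant on $\{z:(t,z)\in A\}$. Then there exist $\delta>0$, an open neighborhood $V\subseteq A\cap\big((-\delta,\delta)\times\mathbb C\big)$ of $(0,p)$, and finitely many (possibly no) functions $c_1,\dots,c_N:(-\delta,\delta)\to\mathbb C$ such that: (i) each $c_i$ is analytic in a rational power of $t$, with $c_i(0)=p$: there are an integer $n_i\ge 1$ and a holomorphic function $g_i$ on the disc $|s|<\delta^{1/n_i}$ such that $c_i(t)=g_i(t^{1/n_i})$ for $|t|<\delta$, where $t^{1/n}=|t|^{1/n}e^{i\pi/n}$ if $t<0$; (ii) $(t,c_i(t))\in A$ and $f(t,c_i(t))=0$ for all $i$ and all $|t|<\delta$; (iii) every zero $(t,z)\in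 V$ of $f$ with $t\neq 0$ has the form $(t,c_i(t))$ for some $i$; and if $f(0,\cdot)$ does not vanish identically near $p$, the same holds for the zeros $(0,z)\in V$ with $t=0$. -/

import Mathlib

open Filter Topology

/-- `f`, a function of a real variable `t` and a complex variable `z`, is analytic on `A`:
around each point `(t₀, z₀)` of `A` it is the sum of a convergent power series in the two variables
`t - t₀` and `z - z₀`, with complex coefficients. -/
def IsAnalyticRealComplexOn (f : ℝ × ℂ → ℂ) (A : Set (ℝ × ℂ)) : Prop :=
  ∀ t₀ : ℝ, ∀ z₀ : ℂ, (t₀, z₀) ∈ A →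
    ∃ a : ℕ → ℕ → ℂ, ∃ r : ℝ, 0 < r ∧
      ∀ t : ℝ, ∀ z : ℂ, |t - t₀| < r → ‖z - z₀‖ < r →
        HasSum (fun k : ℕ × ℕ => a k.1 k.2 * ((t - t₀ : ℝ) : ℂ) ^ k.1 * (z - z₀) ^ k.2) (f (t, z))

/-- On the interval `(-δ, δ)` the function `c` is analytic in a rational power of `t`: there are
`n ≥ 1` and a function `g`, analytic on the disc `|s| < δ ^ (1 / n)`, with `c t = g (t ^ (1 / n))`.
Here `t ^ (1 / n)` is the principal root, that is, the nonnegative real root if `t ≥ 0`, and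
`|t| ^ (1 / n) * exp (i π / n)` if `t < 0`.
(A function analytic in `t ^ (m / n)` is also analytic in `t ^ (1 / n)`.) -/
def IsAnalyticInRationalPower (c : ℝ → ℂ) (δ : ℝ) : Prop :=
  ∃ n : ℕ, 1 ≤ n ∧ ∃ g : ℂ → ℂ,
    AnalyticOnNhd ℂ g (Metric.ball 0 (δ ^ (1 / (n : ℝ)))) ∧
      ∀ t : ℝ, |t| < δ → c t = g ((t : ℂ) ^ (1 / (n : ℂ)))

/-!
Replacing the real variable `t` by a complex one in the expansion of `f` at `(0, p)` gives a function
`F` of two complex variables, analytic at the origin. It is not identically zero there: otherwise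
`f` would vanish on the connected set `A` by the identity theorem, and its slices would be constant.
Hence `F = t ^ m * G` with `G (0, ·)` not identically zero, and the statement follows from the local
form of Puiseux's theorem `hasPuiseuxCover`: near the origin the zeros of `G` lie on finitely many
branches `s ↦ (s ^ n, g s)`. Using all conjugate branches `s ↦ g (ζ * s)` with `ζ ^ n = 1`, one may
take for `s` the principal root `t ^ (1 / n)`. If `f (0, ·)` does not vanish identically near `p`,
then `m = 0`, so the zeros with `t = 0` are covered too.

Puiseux's theorem is proved by strong induction on the order `D` of `G (0, ·)` at `0`, without the
Weierstrass preparation theorem. By the implicit function theorem the derivative of order `D - 1` of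
`G` in `z` vanishes along an analytic curve `z = h t`; after translation by `h`, the expansion
`G = ∑ k < D, a_k(t) z ^ k + z ^ D * E` has `a_(D-1) = 0` (`exists_tschirnhaus`). If all `a_k` vanish,
then `z = 0` is the only branch. Otherwise the least Newton slope `u / v` and the
substitution `t = s ^ v`, `z = s ^ u * w` give `G = s ^ (u D) * H (s, w)`, where `H (0, ·)` is a
polynomial of degree `D` which is not a monomial and whose coefficient of degree `D - 1` vanishes. So
its roots have multiplicity less than `D`, and the induction hypothesis applies at each of them. On the
zero set `w` stays bounded, and by compactness of a disc these finitely many local coverings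
suffice (`HasPuiseuxCover.of_normal_form`).
-/

/-! ### Double power series -/

/-- On the polydisc of radius `r` around the origin of `ℂ × ℂ`, the function `G` is the sum of the
double power series with coefficients `a`. -/
def HasDoubleSeries (G : ℂ × ℂ → ℂ) (a : ℕ → ℕ → ℂ) (r : ℝ) : Prop :=
  ∀ t z : ℂ, ‖t‖ < r → ‖z‖ < r →
    HasSum (fun k : ℕ × ℕ => a k.1 k.2 * t ^ k.1 * z ^ k.2) (G (t, z))

/-- The `n`-linear form on `ℂ × ℂ` whose diagonal value at `(t, z)` is `t ^ j * z ^ (n - j)`. -/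
noncomputable def monomialForm (n j : ℕ) :
    ContinuousMultilinearMap ℂ (fun _ : Fin n => ℂ × ℂ) ℂ :=
  (ContinuousMultilinearMap.mkPiAlgebra ℂ (Fin n) ℂ).compContinuousLinearMap fun i =>
    if (i : ℕ) < j then ContinuousLinearMap.fst ℂ ℂ ℂ else ContinuousLinearMap.snd ℂ ℂ ℂ

lemma monomialForm_diag (j k : ℕ) (y : ℂ × ℂ) :
    monomialForm (j + k) j (fun _ => y) = y.1 ^ j * y.2 ^ k := by
  simp only [monomialForm, ContinuousMultilinearMap.compContinuousLinearMap_apply,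
    ContinuousMultilinearMap.mkPiAlgebra_apply, Fin.prod_univ_add]
  simp

lemma norm_monomialForm_le (n j : ℕ) : ‖monomialForm n j‖ ≤ 1 := by
  refine (ContinuousMultilinearMap.norm_compContinuousLinearMap_le _ _).trans ?_
  rw [ContinuousMultilinearMap.norm_mkPiAlgebra, one_mul]
  refine Finset.prod_le_one (fun _ _ => norm_nonneg _) fun i _ => ?_
  split_ifs
  · exact ContinuousLinearMap.norm_fst_le ℂ ℂ ℂ
  · exact ContinuousLinearMap.norm_snd_le ℂ ℂ ℂ

lemma HasDoubleSeries.analyticAt {G : ℂ × ℂ → ℂ} {a : ℕ → ℕ → ℂ} {r : ℝ} (hr : 0 < r)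
    (h : HasDoubleSeries G a r) : AnalyticAt ℂ G 0 := by
  obtain ⟨ρ, hρ0, hρr⟩ : ∃ ρ : NNReal, 0 < ρ ∧ (ρ : ℝ) < r := by
    obtain ⟨ρ, hρ0, hρr⟩ := exists_between hr
    lift ρ to NNReal using hρ0.le
    exact ⟨ρ, by exact_mod_cast hρ0, hρr⟩
  let p : FormalMultilinearSeries ℂ (ℂ × ℂ) ℂ := fun n =>
    ∑ x ∈ Finset.HasAntidiagonal.antidiagonal n, a x.1 x.2 • monomialForm n x.1
  have hS : Summable fun k : ℕ × ℕ => ‖a k.1 k.2‖ * (ρ : ℝ) ^ (k.1 + k.2) := by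
    have := (h (ρ : ℝ) (ρ : ℝ) (by simpa using hρr) (by simpa using hρr)).summable.norm
    simpa [pow_add, mul_assoc] using this
  refine ⟨p, ρ, ?_, by exact_mod_cast hρ0, ?_⟩
  · refine p.le_radius_of_bound (∑' k : ℕ × ℕ, ‖a k.1 k.2‖ * (ρ : ℝ) ^ (k.1 + k.2)) fun n => ?_
    calc ‖p n‖ * (ρ : ℝ) ^ n
        ≤ (∑ x ∈ Finset.HasAntidiagonal.antidiagonal n, ‖a x.1 x.2‖) * (ρ : ℝ) ^ n := by
          gcongr
          refine norm_sum_le_of_le _ fun x _ => ?_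
          rw [norm_smul]
          exact mul_le_of_le_one_right (norm_nonneg _) (norm_monomialForm_le _ _)
      _ = ∑ x ∈ Finset.HasAntidiagonal.antidiagonal n, ‖a x.1 x.2‖ * (ρ : ℝ) ^ (x.1 + x.2) := by
          rw [Finset.sum_mul]
          refine Finset.sum_congr rfl fun x hx => ?_
          rw [Finset.HasAntidiagonal.mem_antidiagonal.1 hx]
      _ ≤ _ := hS.sum_le_tsum _ fun _ _ => by positivity
  · rintro ⟨t, z⟩ hy
    rw [Metric.mem_eball, edist_zero_right, enorm_lt_coe, ← NNReal.coe_lt_coe, coe_nnnorm,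
      Prod.norm_def, max_lt_iff] at hy
    have h1 := h t z (hy.1.trans hρr) (hy.2.trans hρr)
    rw [← Finset.HasAntidiagonal.sigmaAntidiagonalEquivProd.hasSum_iff] at h1
    have h2 := h1.sigma (g := fun n => p n fun _ => (t, z)) fun n => ?_
    · simpa using h2
    · convert! hasSum_fintype _
      simp only [p, sum_apply, smul_apply]
      rw [← Finset.sum_coe_sort]
      refine Finset.sum_congr rfl ?_
      rintro ⟨⟨j, k⟩, hx⟩ -
      obtain rfl := Finset.HasAntidiagonal.mem_antidiagonal.1 hx
      simp [monomialForm_diag, mul_assoc]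

/-- An analytic function of two variables is the sum of a double power series: expand the
multilinear terms along the two coordinate axes and collect equal monomials. -/
lemma AnalyticAt.exists_hasDoubleSeries {G : ℂ × ℂ → ℂ} (hG : AnalyticAt ℂ G 0) :
    ∃ a : ℕ → ℕ → ℂ, ∃ r : ℝ, 0 < r ∧ HasDoubleSeries G a r := by
  obtain ⟨p, R, hp⟩ := hG
  obtain ⟨R', hR'0, hR'⟩ := ENNReal.lt_iff_exists_nnreal_btwn.1 hp.r_pos
  have hR'pos : (0 : ℝ) < R' := by exact_mod_cast hR'0
  -- the coefficients, before collecting equal monomials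
  let c : (Σ n : ℕ, Finset (Fin n)) → ℂ := fun b =>
    p b.1 (b.2.piecewise (fun _ => ((1 : ℂ), (0 : ℂ))) fun _ => ((0 : ℂ), (1 : ℂ)))
  let e : (Σ n : ℕ, Finset (Fin n)) → ℕ × ℕ := fun b => (b.2.card, b.1 - b.2.card)
  have hcard : ∀ b : Σ n : ℕ, Finset (Fin n), (e b).1 + (e b).2 = b.1 := fun b => by
    have := b.2.card_le_univ
    simp only [Fintype.card_fin] at this
    simp only [e]; omega
  have hterm : ∀ (t z : ℂ) (n : ℕ), (p n fun _ => (t, z)) =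
      ∑ s : Finset (Fin n), c ⟨n, s⟩ * (t ^ (e ⟨n, s⟩).1 * z ^ (e ⟨n, s⟩).2) := by
    intro t z n
    have h1 : (fun _ : Fin n => (t, z)) =
        (fun _ => t • ((1 : ℂ), (0 : ℂ))) + fun _ => z • ((0 : ℂ), (1 : ℂ)) := by
      ext i <;> simp
    rw [h1, ContinuousMultilinearMap.map_add_univ]
    refine Finset.sum_congr rfl fun s _ => ?_
    have h2 : s.piecewise (fun _ : Fin n => t • ((1 : ℂ), (0 : ℂ)))
        (fun _ => z • ((0 : ℂ), (1 : ℂ))) = fun i => (s.piecewise (fun _ => t) (fun _ => z) i) •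
          (s.piecewise (fun _ => ((1 : ℂ), (0 : ℂ))) (fun _ => ((0 : ℂ), (1 : ℂ))) i) := by
      funext i
      by_cases hi : i ∈ s <;> simp [hi]
    rw [h2, ContinuousMultilinearMap.map_smul_univ, Finset.prod_piecewise]
    simp [c, e, mul_comm, Finset.card_sdiff, Finset.inter_univ]
  have hcn : ∀ b, ‖c b‖ ≤ ‖p b.1‖ := fun b => by
    refine ((p b.1).le_opNorm _).trans (mul_le_of_le_one_right (norm_nonneg _) ?_)
    refine Finset.prod_le_one (fun _ _ => norm_nonneg _) fun i _ => ?_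
    by_cases hi : i ∈ b.2 <;> simp [hi, Prod.norm_def]
  have hsum : ∀ t z : ℂ, ‖t‖ < R' / 2 → ‖z‖ < R' / 2 →
      HasSum (fun b => c b * (t ^ (e b).1 * z ^ (e b).2)) (G (t, z)) := by
    intro t z ht hz
    have hS : Summable fun b => c b * (t ^ (e b).1 * z ^ (e b).2) := by
      have hb : ∀ b, ‖c b * (t ^ (e b).1 * z ^ (e b).2)‖ ≤ ‖p b.1‖ * ((R' : ℝ) / 2) ^ b.1 := by
        intro b
        rw [norm_mul, norm_mul, norm_pow, norm_pow, ← hcard b, pow_add]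
        have := hcn b
        rw [← hcard b] at this
        gcongr
      refine Summable.of_norm_bounded ?_ hb
      rw [summable_sigma_of_nonneg (fun _ => by positivity)]
      refine ⟨fun n => Summable.of_finite, ?_⟩
      have := p.summable_norm_mul_pow (hR'.trans_le hp.r_le)
      refine this.congr fun n => ?_
      rw [tsum_fintype]
      change _ = ∑ _b : Finset (Fin n), ‖p n‖ * ((R' : ℝ) / 2) ^ n
      rw [Finset.sum_const, Finset.card_univ, Fintype.card_finset, Fintype.card_fin,
        nsmul_eq_mul, div_pow]
      push_cast
      field_simp
    have h1 := hS.hasSum.sigma (g := fun n => p n fun _ => (t, z)) fun n => by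
      rw [hterm]; exact hasSum_fintype _
    have h2 := hp.hasSum (y := (t, z)) (by
      rw [Metric.mem_eball, edist_zero_right]
      refine lt_trans ?_ hR'
      rw [enorm_lt_coe, ← NNReal.coe_lt_coe, coe_nnnorm, Prod.norm_def, max_lt_iff]
      constructor <;> simp only <;> linarith)
    rw [zero_add] at h2
    rw [h2.unique h1]
    exact hS.hasSum
  refine ⟨fun j k => ∑' b : {b // e b = (j, k)}, c b, R' / 2, by positivity, fun t z ht hz => ?_⟩
  have h1 := hsum t z ht hz
  rw [← (Equiv.sigmaFiberEquiv e).hasSum_iff] at h1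
  refine h1.sigma fun ⟨j, k⟩ => ?_
  have hfib : Summable fun b : {b // e b = (j, k)} => c b := by
    -- summability at one point with nonzero coordinates gives summability of the coefficients
    have hρ : ‖((R' / 4 : ℝ) : ℂ)‖ < R' / 2 := by
      rw [Complex.norm_real, Real.norm_of_nonneg (by positivity)]; linarith
    have h3 := (hsum _ _ hρ hρ).summable.comp_injective
      (Subtype.val_injective (p := fun b => e b = (j, k)))
    have h4 : (((R' / 4 : ℝ) : ℂ) ^ j * ((R' / 4 : ℝ) : ℂ) ^ k) ≠ 0 := by
      have : ((R' / 4 : ℝ) : ℂ) ≠ 0 := by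
        rw [Complex.ofReal_ne_zero]; positivity
      positivity
    rw [← summable_mul_right_iff h4]
    refine h3.congr fun b => ?_
    simp [b.2]
  simp only [mul_assoc]
  refine (hfib.hasSum.mul_right (t ^ j * z ^ k)).congr_fun ?_
  rintro ⟨b, hb⟩
  simp [hb]


/-- Dividing a double power series formally by `t ^ m * z ^ n` keeps its polydisc of convergence. -/
lemma HasDoubleSeries.summable_shift {G : ℂ × ℂ → ℂ} {a : ℕ → ℕ → ℂ} {r : ℝ}
    (h : HasDoubleSeries G a r) (m n : ℕ) {t z : ℂ} (ht : ‖t‖ < r) (hz : ‖z‖ < r) :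
    Summable fun k : ℕ × ℕ => a (k.1 + m) (k.2 + n) * t ^ k.1 * z ^ k.2 := by
  -- shrinking `|t|` and `|z|` is harmless, so compare with a point where both are nonzero
  obtain ⟨ρ, hρ, hρr⟩ := exists_between (max_lt ht hz)
  obtain ⟨htρ, hzρ⟩ := max_lt_iff.1 hρ
  have hρ0 : 0 < ρ := (norm_nonneg _).trans_lt htρ
  have hρr' : ‖(ρ : ℂ)‖ < r := by rwa [Complex.norm_real, Real.norm_of_nonneg hρ0.le]
  have h1 := (h ρ ρ hρr' hρr').summable.norm
  have h2 := (h1.comp_injective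
    (i := fun k : ℕ × ℕ => (k.1 + m, k.2 + n)) (fun x y hxy => by
      simp only [Prod.mk.injEq, Nat.add_right_cancel_iff] at hxy
      exact Prod.ext hxy.1 hxy.2)).mul_right ((ρ ^ m)⁻¹ * (ρ ^ n)⁻¹)
  refine Summable.of_norm_bounded h2 fun k => ?_
  calc ‖a (k.1 + m) (k.2 + n) * t ^ k.1 * z ^ k.2‖
      ≤ ‖a (k.1 + m) (k.2 + n)‖ * ρ ^ k.1 * ρ ^ k.2 := by
        rw [norm_mul, norm_mul, norm_pow, norm_pow]; gcongr
    _ = _ := by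
        simp only [Function.comp_apply, norm_mul, norm_pow, Complex.norm_real,
          Real.norm_of_nonneg hρ0.le, pow_add]
        field_simp

/-! ### Factoring out powers of the variables -/

/-- Splitting off the factor `z`: an analytic function of two variables differs from its restriction
to `z = 0` by `z` times an analytic function. -/
lemma AnalyticAt.exists_eq_add_mul {G : ℂ × ℂ → ℂ} (hG : AnalyticAt ℂ G 0) :
    ∃ E : ℂ × ℂ → ℂ, AnalyticAt ℂ E 0 ∧
      ∀ᶠ x in 𝓝 (0 : ℂ × ℂ), G x = G (x.1, 0) + x.2 * E x := by
  obtain ⟨a, r, hr, h⟩ := hG.exists_hasDoubleSeries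
  have key := fun t z ht hz => h.summable_shift 0 1 (t := t) (z := z) ht hz
  simp only [add_zero] at key
  refine ⟨fun x => ∑' k : ℕ × ℕ, a k.1 (k.2 + 1) * x.1 ^ k.1 * x.2 ^ k.2,
    HasDoubleSeries.analyticAt (a := fun j k => a j (k + 1)) hr
      fun t z ht hz => (key t z ht hz).hasSum, ?_⟩
  filter_upwards [Metric.ball_mem_nhds (0 : ℂ × ℂ) hr] with ⟨t, z⟩ hx
  rw [mem_ball_zero_iff, Prod.norm_def, max_lt_iff] at hx
  obtain ⟨ht, hz⟩ := hx
  have e1 := (h t z ht hz)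
  have e0 := (h t 0 ht (by simpa using hr))
  have e2 := ((key t z ht hz).hasSum.mul_left z)
  have hinj : Function.Injective (fun k : ℕ × ℕ => (k.1, k.2 + 1)) := fun x y hxy => by
    simp only [Prod.mk.injEq, Nat.add_right_cancel_iff] at hxy
    exact Prod.ext hxy.1 hxy.2
  -- `G (t, z) - G (t, 0)` is the sum over the exponents with `k ≥ 1`
  have e3 := (hinj.hasSum_iff (f := fun k : ℕ × ℕ => a k.1 k.2 * t ^ k.1 * z ^ k.2 -
    a k.1 k.2 * t ^ k.1 * 0 ^ k.2) (a := G (t, z) - G (t, 0)) (fun x hx => by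
      rcases x with ⟨j, _ | k⟩
      · simp
      · exact absurd ⟨(j, k), rfl⟩ hx)).2 (e1.sub e0)
  have e4 := e3.unique (e2.congr_fun fun k => by simp [pow_succ]; ring)
  simp only at e4 ⊢
  linear_combination e4

/-- A nonzero double power series is a power of `t` times an analytic function which does not vanish
identically on `t = 0`. -/
lemma HasDoubleSeries.exists_eq_pow_mul {F : ℂ × ℂ → ℂ} {a : ℕ → ℕ → ℂ} {r : ℝ} (hr : 0 < r)
    (h : HasDoubleSeries F a r) (hne : ¬ ∀ᶠ x in 𝓝 (0 : ℂ × ℂ), F x = 0) :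
    ∃ (m : ℕ) (G : ℂ × ℂ → ℂ), AnalyticAt ℂ G 0 ∧ (¬ ∀ᶠ z in 𝓝 0, G (0, z) = 0) ∧
      ∀ᶠ x in 𝓝 (0 : ℂ × ℂ), F x = x.1 ^ m * G x := by
  classical
  have hball : ∀ᶠ x in 𝓝 (0 : ℂ × ℂ), ‖x.1‖ < r ∧ ‖x.2‖ < r := by
    filter_upwards [Metric.ball_mem_nhds (0 : ℂ × ℂ) hr] with x hx
    rwa [mem_ball_zero_iff, Prod.norm_def, max_lt_iff] at hx
  have hex : ∃ j k, a j k ≠ 0 := by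
    by_contra! h0
    refine hne ?_
    filter_upwards [hball] with x hx
    refine (h x.1 x.2 hx.1 hx.2).unique ?_
    simp [h0]
  obtain ⟨k₀, hk₀⟩ := Nat.find_spec hex
  set m := Nat.find hex with hm
  have hlt : ∀ j < m, ∀ k, a j k = 0 := fun j hj k => by
    by_contra h0
    exact Nat.find_min hex hj ⟨k, h0⟩
  have key := fun t z ht hz => h.summable_shift m 0 (t := t) (z := z) ht hz
  simp only [add_zero] at key
  let G : ℂ × ℂ → ℂ := fun x => ∑' k : ℕ × ℕ, a (k.1 + m) k.2 * x.1 ^ k.1 * x.2 ^ k.2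
  have hG : HasDoubleSeries G (fun j k => a (j + m) k) r := fun t z ht hz => (key t z ht hz).hasSum
  refine ⟨m, G, hG.analyticAt hr, fun h0 => hk₀ ?_, ?_⟩
  · -- on `t = 0` the function `G` is the power series with coefficients `a m k`
    have hser : HasFPowerSeriesAt (fun z => G (0, z))
        (FormalMultilinearSeries.ofScalars ℂ (a m)) 0 := by
      rw [hasFPowerSeriesAt_iff]
      filter_upwards [Metric.ball_mem_nhds (0 : ℂ) hr] with z hz
      have h1 := hG 0 z (by simpa using hr) (by simpa using hz)
      have hinj : Function.Injective (fun k : ℕ => ((0 : ℕ), k)) := fun x y hxy => by simpa using hxy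
      rw [← hinj.hasSum_iff] at h1
      · simpa [Function.comp_def, FormalMultilinearSeries.coeff_ofScalars, mul_comm] using h1
      · rintro ⟨_ | j, k⟩ hx
        · exact absurd ⟨k, rfl⟩ hx
        · simp
    have h2 := (hser.congr (g := 0) h0).eq_zero
    have h3 := congrArg (fun p => FormalMultilinearSeries.coeff p k₀) h2
    rw [FormalMultilinearSeries.coeff_ofScalars] at h3
    exact h3.trans (by simp [FormalMultilinearSeries.coeff])
  · filter_upwards [hball] with ⟨t, z⟩ ⟨ht, hz⟩
    have hinj : Function.Injective (fun k : ℕ × ℕ => (k.1 + m, k.2)) := fun x y hxy => by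
      simp only [Prod.mk.injEq, Nat.add_right_cancel_iff] at hxy
      exact Prod.ext hxy.1 hxy.2
    have h1 := h t z ht hz
    rw [← hinj.hasSum_iff] at h1
    · refine h1.unique (((hG t z ht hz).mul_left (t ^ m)).congr_fun fun k => ?_)
      simp [pow_add]; ring
    · rintro ⟨j, k⟩ hx
      rw [hlt j, zero_mul, zero_mul]
      by_contra! hj
      exact hx ⟨(j - m, k), by simp [hj]⟩

/-- Taylor expansion in the second variable with an analytic remainder, the coefficients being
analytic functions of the first variable. -/
lemma AnalyticAt.exists_eq_sum_add_pow_mul_snd {G : ℂ × ℂ → ℂ} (hG : AnalyticAt ℂ G 0) (d : ℕ) :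
    ∃ (a : ℕ → ℂ → ℂ) (E : ℂ × ℂ → ℂ), (∀ k, AnalyticAt ℂ (a k) 0) ∧ AnalyticAt ℂ E 0 ∧
      ∀ᶠ x in 𝓝 (0 : ℂ × ℂ), G x = ∑ k ∈ Finset.range d, a k x.1 * x.2 ^ k + x.2 ^ d * E x := by
  induction d with
  | zero => exact ⟨fun _ _ => 0, G, fun _ => analyticAt_const, hG, by simp⟩
  | succ d ih =>
    obtain ⟨a, E, ha, hE, h⟩ := ih
    obtain ⟨E', hE', h'⟩ := hE.exists_eq_add_mul
    refine ⟨Function.update a d fun t => E (t, 0), E', fun k => ?_, hE', ?_⟩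
    · rcases eq_or_ne k d with rfl | hk
      · rw [Function.update_self]
        exact hE.fun_comp_of_eq (f := fun t : ℂ => (t, (0 : ℂ)))
          (analyticAt_id.prod analyticAt_const) rfl
      · rw [Function.update_of_ne hk]; exact ha k
    · filter_upwards [h, h'] with x hx hx'
      have hs : ∑ k ∈ Finset.range d, Function.update a d (fun t => E (t, 0)) k x.1 * x.2 ^ k =
          ∑ k ∈ Finset.range d, a k x.1 * x.2 ^ k :=
        Finset.sum_congr rfl fun k hk => by rw [Function.update_of_ne (Finset.mem_range.1 hk).ne]
      rw [Finset.sum_range_succ, Function.update_self, hs, hx, hx']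
      ring

/-! ### The Tschirnhaus normal form -/

lemma AnalyticAt.deriv_snd {K : ℂ × ℂ → ℂ} {x : ℂ × ℂ} (hK : AnalyticAt ℂ K x) :
    AnalyticAt ℂ (fun y : ℂ × ℂ => deriv (fun z => K (y.1, z)) y.2) x := by
  have h1 : AnalyticAt ℂ (fun y => fderiv ℂ K y ((0 : ℂ), (1 : ℂ))) x :=
    (ContinuousLinearMap.apply ℂ ℂ ((0 : ℂ), (1 : ℂ))).analyticAt _ |>.comp hK.fderiv
  refine h1.congr ?_
  filter_upwards [hK.eventually_analyticAt] with y hy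
  exact (hy.differentiableAt.hasFDerivAt.comp_hasDerivAt y.2
    (f := fun z => (y.1, z)) ((hasDerivAt_const _ _).prodMk (hasDerivAt_id _))).deriv.symm

lemma AnalyticAt.iteratedDeriv_snd {G : ℂ × ℂ → ℂ} {x : ℂ × ℂ} (hG : AnalyticAt ℂ G x) (k : ℕ) :
    AnalyticAt ℂ (fun y : ℂ × ℂ => iteratedDeriv k (fun z => G (y.1, z)) y.2) x := by
  induction k with
  | zero => simpa using hG
  | succ k ih =>
    simp only [iteratedDeriv_succ]
    exact ih.deriv_snd

/-- The analytic implicit function theorem for one scalar equation in one unknown. -/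
lemma AnalyticAt.exists_implicit {K : ℂ × ℂ → ℂ} (hK : AnalyticAt ℂ K 0) (h0 : K 0 = 0)
    (h1 : deriv (fun z => K (0, z)) 0 ≠ 0) :
    ∃ h : ℂ → ℂ, AnalyticAt ℂ h 0 ∧ h 0 = 0 ∧ ∀ᶠ t in 𝓝 0, K (t, h t) = 0 := by
  have hc : ContDiffAt ℂ ⊤ K 0 := hK.contDiffAt
  have hd : (fderiv ℂ K 0 ∘L .inr ℂ ℂ ℂ) 1 = deriv (fun z => K (0, z)) 0 :=
    (hK.differentiableAt.hasFDerivAt.comp_hasDerivAt (0 : ℂ)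
      (f := fun z => ((0 : ℂ), z)) ((hasDerivAt_const _ _).prodMk (hasDerivAt_id _))).deriv.symm
  have hinv : (fderiv ℂ K 0 ∘L .inr ℂ ℂ ℂ).IsInvertible := by
    refine ⟨ContinuousLinearEquiv.unitsEquivAut ℂ (Units.mk0 _ h1), ?_⟩
    ext
    rw [hd]
    simp
  refine ⟨hc.implicitFunction (by simp) hinv, ?_, hc.implicitFunction_apply_self _ hinv, ?_⟩
  · exact (hc.contDiffAt_implicitFunction _ hinv).analyticAt
  · simpa [h0] using hc.eventually_apply_implicitFunction (by simp) hinv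

lemma iteratedDeriv_eq_of_taylor {φ e : ℂ → ℂ} {c : ℕ → ℂ} {n m : ℕ} (he : AnalyticAt ℂ e 0)
    (h : ∀ᶠ z in 𝓝 0, φ z = ∑ k ∈ Finset.range n, c k * z ^ k + z ^ n * e z) (hm : m < n) :
    iteratedDeriv m φ 0 = c m * m.factorial := by
  have h1 : AnalyticAt ℂ (fun z : ℂ => z ^ n * e z) 0 := by fun_prop
  have h2 : iteratedDeriv m (fun z : ℂ => z ^ n * e z) 0 = 0 := by
    refine (natCast_le_analyticOrderAt_iff_iteratedDeriv_eq_zero h1).1 ?_ m hm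
    exact (natCast_le_analyticOrderAt h1).2 ⟨e, he, by simp⟩
  have h3 : AnalyticAt ℂ (fun z : ℂ => ∑ k ∈ Finset.range n, c k * z ^ k) 0 :=
    Finset.analyticAt_fun_sum _ fun i hi => by fun_prop
  rw [Filter.EventuallyEq.iteratedDeriv_eq m h, iteratedDeriv_fun_add h3.contDiffAt h1.contDiffAt,
    h2]
  simp (disch := fun_prop) only [iteratedDeriv_fun_sum, iteratedDeriv_const_mul_field,
      iteratedDeriv_fun_pow_zero]
  simp [hm]

/-- The Tschirnhaus normal form. If `G (0, ·)` vanishes to order `d + 1` at `0`, then after a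
translation `z ↦ z + h t` the Taylor coefficient of `z ^ d` vanishes identically. -/
lemma exists_tschirnhaus {G : ℂ × ℂ → ℂ} (hG : AnalyticAt ℂ G 0) {d : ℕ}
    (hd : analyticOrderAt (fun z => G (0, z)) 0 = (d + 1 : ℕ)) :
    ∃ (h : ℂ → ℂ) (a : ℕ → ℂ → ℂ) (E : ℂ × ℂ → ℂ), AnalyticAt ℂ h 0 ∧ h 0 = 0 ∧
      (∀ k, AnalyticAt ℂ (a k) 0) ∧ (∀ k < d + 1, a k 0 = 0) ∧ (∀ᶠ t in 𝓝 0, a d t = 0) ∧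
      AnalyticAt ℂ E 0 ∧ E 0 ≠ 0 ∧ ∀ᶠ x in 𝓝 (0 : ℂ × ℂ), G (x.1, x.2 + h x.1) =
        ∑ k ∈ Finset.range (d + 1), a k x.1 * x.2 ^ k + x.2 ^ (d + 1) * E x := by
  have hG0 : AnalyticAt ℂ (fun z => G (0, z)) 0 :=
    hG.fun_comp_of_eq (f := fun z : ℂ => ((0 : ℂ), z)) (analyticAt_const.prod analyticAt_id) rfl
  obtain ⟨hd1, hd2⟩ := analyticOrderAt_eq_nat_iff_iteratedDeriv_eq_zero hG0 |>.1 hd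
  -- `h` is the root near `0` of the `d`-th derivative in `z`, a simple root when `t = 0`
  obtain ⟨h, hh, hh0, hK⟩ := (hG.iteratedDeriv_snd d).exists_implicit (hd1 d d.lt_succ_self) (by
    simpa [iteratedDeriv_succ] using hd2)
  have hG1 : AnalyticAt ℂ (fun x : ℂ × ℂ => G (x.1, x.2 + h x.1)) 0 := by
    refine hG.fun_comp_of_eq (f := fun x : ℂ × ℂ => (x.1, x.2 + h x.1)) ?_ (by simp [hh0])
    have : AnalyticAt ℂ (fun x : ℂ × ℂ => h x.1) 0 :=
      hh.fun_comp_of_eq (f := fun x : ℂ × ℂ => x.1) analyticAt_fst rfl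
    exact analyticAt_fst.prod (analyticAt_snd.add this)
  obtain ⟨a, E, ha, hE, hexp⟩ := hG1.exists_eq_sum_add_pow_mul_snd (d + 1)
  have hslice : Tendsto (fun t : ℂ => (t, (0 : ℂ))) (𝓝 0) (𝓝 0) :=
    (by fun_prop : Continuous fun t : ℂ => (t, (0 : ℂ))).tendsto' _ _ rfl
  have hcoef : ∀ᶠ t in 𝓝 (0 : ℂ), ∀ k < d + 1,
      iteratedDeriv k (fun z => G (t, z)) (h t) = a k t * k.factorial := by
    filter_upwards [hslice.eventually hexp.eventually_nhds,
      hslice.eventually hE.eventually_analyticAt] with t ht hEt k hk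
    have e1 : iteratedDeriv k (fun z => G (t, z + h t)) 0 = a k t * k.factorial := by
      refine iteratedDeriv_eq_of_taylor (c := fun k => a k t) (e := fun z => E (t, z)) ?_ ?_ hk
      · exact hEt.fun_comp_of_eq (f := fun z : ℂ => (t, z)) (analyticAt_const.prod analyticAt_id) rfl
      · exact ((by fun_prop : Continuous fun z : ℂ => (t, z)).tendsto 0).eventually ht
    rw [← e1, iteratedDeriv_comp_add_const k (fun z => G (t, z)) (h t)]
    simp
  have ha0 : ∀ k < d + 1, a k 0 = 0 := fun k hk => by
    have := hcoef.self_of_nhds k hk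
    rw [hh0, hd1 k hk] at this
    simpa [Nat.factorial_ne_zero] using this.symm
  refine ⟨h, a, E, hh, hh0, ha, ha0, ?_, hE, ?_, hexp⟩
  · filter_upwards [hcoef, hK] with t h1 h2
    have := h1 d d.lt_succ_self
    change iteratedDeriv d (fun z => G (t, z)) (h t) = 0 at h2
    rw [h2] at this
    simpa [Nat.factorial_ne_zero] using this.symm
  · have hE0 : AnalyticAt ℂ (fun z => E (0, z)) 0 :=
      hE.fun_comp_of_eq (f := fun z : ℂ => ((0 : ℂ), z)) (analyticAt_const.prod analyticAt_id) rfl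
    have h1 : (fun z => G (0, z)) =ᶠ[𝓝 0] (fun z => z) ^ (d + 1) * fun z => E (0, z) := by
      have := ((by fun_prop : Continuous fun z : ℂ => ((0 : ℂ), z)).tendsto 0).eventually hexp
      filter_upwards [this] with z hz
      simp only [hh0, add_zero] at hz
      rw [hz, Finset.sum_eq_zero fun k hk => by rw [ha0 k (Finset.mem_range.1 hk), zero_mul]]
      simp
    rw [analyticOrderAt_congr h1, analyticOrderAt_mul (by fun_prop) hE0,
      analyticOrderAt_pow (by fun_prop)] at hd
    have h2 : analyticOrderAt (fun z : ℂ => z) 0 = 1 := analyticOrderAt_id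
    rw [h2, nsmul_one] at hd
    exact hE0.analyticOrderAt_eq_zero.1 (by
      have h3 := ENat.add_right_injective_of_ne_top (n := ((d + 1 : ℕ) : ℕ∞)) (by simp)
      exact h3 (by simpa using hd))

/-! ### Branches of the zero set -/

/-- The pair `b = (n, g)` encodes the branch `z = g (t ^ (1 / n))` of the zero set of `G`, in the
parametrized form `s ↦ (s ^ n, g s)`. -/
def IsPuiseuxBranch (G : ℂ × ℂ → ℂ) (b : ℕ × (ℂ → ℂ)) : Prop :=
  1 ≤ b.1 ∧ AnalyticAt ℂ b.2 0 ∧ b.2 0 = 0 ∧ ∀ᶠ s in 𝓝 0, G (s ^ b.1, b.2 s) = 0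

/-- Near the origin the zero set of `G` is covered by finitely many Puiseux branches through the
origin, each of which consists of zeros of `G`. -/
def HasPuiseuxCover (G : ℂ × ℂ → ℂ) : Prop :=
  ∃ B : Set (ℕ × (ℂ → ℂ)), B.Finite ∧ (∀ b ∈ B, IsPuiseuxBranch G b) ∧
    ∀ᶠ x in 𝓝 (0 : ℂ × ℂ), G x = 0 → ∃ b ∈ B, ∃ s, s ^ b.1 = x.1 ∧ b.2 s = x.2

lemma HasPuiseuxCover.of_translate {G : ℂ × ℂ → ℂ} {h : ℂ → ℂ} (hh : AnalyticAt ℂ h 0)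
    (hh0 : h 0 = 0) (hG : HasPuiseuxCover fun x => G (x.1, x.2 + h x.1)) : HasPuiseuxCover G := by
  obtain ⟨B, hB, hbr, hcov⟩ := hG
  refine ⟨(fun b : ℕ × (ℂ → ℂ) => (b.1, fun s => b.2 s + h (s ^ b.1))) '' B, hB.image _, ?_, ?_⟩
  · rintro _ ⟨b, hb, rfl⟩
    obtain ⟨h1, h2, h3, h4⟩ := hbr b hb
    have hb0 : b.1 ≠ 0 := by omega
    refine ⟨h1, h2.add (hh.fun_comp_of_eq (by fun_prop) (by simp [hb0])), by simp [h3, hh0, hb0], h4⟩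
  · have ht : Tendsto (fun x : ℂ × ℂ => (x.1, x.2 - h x.1)) (𝓝 0) (𝓝 0) := by
      have hc : ContinuousAt (fun x : ℂ × ℂ => h x.1) 0 :=
        ContinuousAt.comp' (f := fun x : ℂ × ℂ => x.1) hh.continuousAt continuousAt_fst
      have : ContinuousAt (fun x : ℂ × ℂ => (x.1, x.2 - h x.1)) 0 :=
        continuousAt_fst.prodMk (continuousAt_snd.sub hc)
      convert! this.tendsto using 2
      simp [hh0, Prod.zero_eq_mk]
    filter_upwards [ht.eventually hcov] with x hx hGx
    obtain ⟨b, hb, s, h1, h2⟩ := hx (by simpa using hGx)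
    refine ⟨_, ⟨b, hb, rfl⟩, s, h1, ?_⟩
    simp only at h1 h2 ⊢
    rw [h1, h2]; ring

lemma eventually_forall_pow_eq {P : ℂ → Prop} (hP : ∀ᶠ s in 𝓝 0, P s) (v : ℕ) :
    ∀ᶠ t in 𝓝 (0 : ℂ), ∀ s, s ^ v = t → P s := by
  obtain ⟨ε, hε, h⟩ := Metric.eventually_nhds_iff_ball.1 hP
  filter_upwards [Metric.ball_mem_nhds (0 : ℂ) (pow_pos hε v)] with t ht s hs
  refine h s ?_
  rw [mem_ball_zero_iff] at ht ⊢
  rw [← hs, norm_pow] at ht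
  exact lt_of_pow_lt_pow_left₀ v hε.le ht

/-! ### The Newton polygon -/

/-- A bound for the roots of a polynomial in terms of its coefficients. -/
lemma norm_le_of_sum_eq_zero {b : ℕ → ℂ} {e w : ℂ} {D : ℕ} {M ε : ℝ} (hε : 0 < ε) (he : ε ≤ ‖e‖)
    (hb : ∀ k < D, ‖b k‖ ≤ M) (h : ∑ k ∈ Finset.range D, b k * w ^ k + w ^ D * e = 0) :
    ‖w‖ ≤ max 1 (D * M / ε) := by
  by_contra! hw
  obtain ⟨hw1, hw2⟩ := max_lt_iff.1 hw
  have hw0 : 0 < ‖w‖ := by linarith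
  have h1 : ‖w‖ ^ D * ε ≤ D * (M * ‖w‖ ^ (D - 1)) := by
    calc ‖w‖ ^ D * ε ≤ ‖w‖ ^ D * ‖e‖ := by gcongr
      _ = ‖∑ k ∈ Finset.range D, b k * w ^ k‖ := by
        rw [← norm_pow, ← norm_mul, ← norm_neg, eq_neg_of_add_eq_zero_left h]
      _ ≤ ∑ k ∈ Finset.range D, M * ‖w‖ ^ (D - 1) := by
        refine norm_sum_le_of_le _ fun k hk => ?_
        have hk' := Finset.mem_range.1 hk
        rw [norm_mul, norm_pow]
        have := hb k hk'
        have hM : 0 ≤ M := (norm_nonneg _).trans this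
        gcongr
        · exact hw1.le
        · omega
      _ = _ := by simp
  rcases D with _ | D
  · simp at h1; linarith
  · rw [div_lt_iff₀ hε] at hw2
    simp only [pow_succ, Nat.add_sub_cancel] at h1
    have : ‖w‖ ^ D * (‖w‖ * ε) ≤ ‖w‖ ^ D * ((D + 1 : ℕ) * M) := by linarith
    have := le_of_mul_le_mul_left this (by positivity)
    linarith

/-- A polynomial of degree `d + 1` whose coefficient of degree `d` vanishes, and which is not a
monomial, has no root of multiplicity `d + 1`. -/
lemma Polynomial.analyticOrderAt_eval_add_lt {Q : Polynomial ℂ} {d : ℕ}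
    (hQ : Q.natDegree = d + 1) (hd : Q.coeff d = 0) (hk : ∃ k < d + 1, Q.coeff k ≠ 0) (w : ℂ) :
    analyticOrderAt (fun z => Q.eval (z + w)) 0 < (d + 1 : ℕ) := by
  by_contra! h
  have hne : Q.coeff (d + 1) ≠ 0 := by
    rw [← hQ, Polynomial.coeff_natDegree]
    rintro h0
    rw [Polynomial.leadingCoeff_eq_zero] at h0
    simp [h0] at hQ
  have han : AnalyticAt ℂ (fun z => Q.eval (z + w)) 0 := by
    have := (AnalyticAt.aeval_polynomial (𝕜 := ℂ) (f := fun z : ℂ => z + w) (z := 0)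
      (by fun_prop) Q)
    simpa using this
  rw [natCast_le_analyticOrderAt_iff_iteratedDeriv_eq_zero han] at h
  have h1 : ∀ m < d + 1, (Q.taylor w).coeff m = 0 := fun m hm => by
    have := iteratedDeriv_eq_of_taylor (φ := fun z => Q.eval (z + w))
      (e := fun _ => (Q.taylor w).coeff (d + 1)) (c := (Q.taylor w).coeff) (n := d + 1)
      analyticAt_const (Eventually.of_forall fun z => by
        rw [← Polynomial.taylor_eval, Polynomial.eval_eq_sum_range, Polynomial.natDegree_taylor, hQ,
          Finset.sum_range_succ, mul_comm (z ^ (d + 1))]) hm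
    rw [h m hm] at this
    simpa [Nat.factorial_ne_zero] using this.symm
  have h2 : Q.taylor w = Polynomial.C (Q.coeff (d + 1)) * Polynomial.X ^ (d + 1) := by
    ext m
    rw [Polynomial.coeff_C_mul_X_pow]
    split_ifs with hm
    · subst hm
      rw [← hQ, Polynomial.coeff_taylor_natDegree, Polynomial.coeff_natDegree]
    · rcases lt_or_gt_of_ne hm with hm | hm
      · exact h1 m hm
      · exact Polynomial.coeff_eq_zero_of_natDegree_lt (by rwa [Polynomial.natDegree_taylor, hQ])
  have h3 : Q = Polynomial.C (Q.coeff (d + 1)) * (Polynomial.X - Polynomial.C w) ^ (d + 1) := by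
    have := congrArg (Polynomial.taylor (-w)) h2
    rw [Polynomial.taylor_taylor] at this
    simpa [sub_eq_add_neg] using this
  have h4 : ∀ k, Q.coeff k = Q.coeff (d + 1) * ((-w) ^ (d + 1 - k) * (d + 1).choose k) := fun k => by
    conv_lhs => rw [h3]
    rw [Polynomial.coeff_C_mul, sub_eq_add_neg, ← Polynomial.C_neg, Polynomial.coeff_X_add_C_pow]
  have hw : w = 0 := by
    have h5 := h4 d
    rw [hd] at h5
    have : (d : ℂ) + 1 ≠ 0 := by exact_mod_cast d.succ_ne_zero
    simpa [hne, this] using h5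
  obtain ⟨k, hk, hk0⟩ := hk
  refine hk0 ?_
  rw [h4 k, hw]
  simp [show d + 1 - k ≠ 0 by omega]

/-- Choice of the slope of the Newton polygon: `u / v` is the least of the slopes
`ord a_k / (D - k)`, and the coefficients become `a_k (s ^ v) = s ^ (u (D - k)) b_k s`. -/
lemma exists_newton_slope {a : ℕ → ℂ → ℂ} {D : ℕ} (ha : ∀ k, AnalyticAt ℂ (a k) 0)
    (ha0 : ∀ k < D, a k 0 = 0) (hne : ∃ k < D, ¬ ∀ᶠ t in 𝓝 0, a k t = 0) :
    ∃ (u v : ℕ) (b : ℕ → ℂ → ℂ), u ≠ 0 ∧ v ≠ 0 ∧ (∀ k, AnalyticAt ℂ (b k) 0) ∧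
      (∀ k < D, ∀ᶠ s in 𝓝 0, a k (s ^ v) = s ^ (u * (D - k)) * b k s) ∧
      (∃ k < D, b k 0 ≠ 0) ∧ ∀ k, (∀ᶠ t in 𝓝 0, a k t = 0) → b k 0 = 0 := by
  classical
  obtain ⟨k₁, hk₁, hne₁⟩ := hne
  -- `u = ord a_k₀` and `v = D - k₀` for a minimizing index `k₀`; they need not be coprime
  obtain ⟨k₀, hk₀, hmin⟩ := Finset.exists_min_image
    ((Finset.range D).filter fun k => ¬ ∀ᶠ t in 𝓝 0, a k t = 0)
    (fun k => (analyticOrderNatAt (a k) 0 : ℚ) / ((D - k : ℕ) : ℚ)) 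
    ⟨k₁, Finset.mem_filter.2 ⟨Finset.mem_range.2 hk₁, hne₁⟩⟩
  obtain ⟨hk₀D, hk₀ne⟩ := Finset.mem_filter.1 hk₀
  rw [Finset.mem_range] at hk₀D
  have hfac : ∀ k, (¬ ∀ᶠ t in 𝓝 0, a k t = 0) → ∃ g : ℂ → ℂ, AnalyticAt ℂ g 0 ∧ g 0 ≠ 0 ∧
      ∀ᶠ t in 𝓝 0, a k t = t ^ analyticOrderNatAt (a k) 0 * g t := fun k hk => by
    have := ((ha k).analyticOrderNatAt_eq_iff (fun h => hk (analyticOrderAt_eq_top.1 h))).1 rfl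
    simpa using this
  have hv : D - k₀ ≠ 0 := by omega
  have hu : analyticOrderNatAt (a k₀) 0 ≠ 0 := fun h0 => by
    obtain ⟨g, -, hg0, hg⟩ := hfac k₀ hk₀ne
    have := hg.self_of_nhds
    rw [h0, pow_zero, one_mul, ha0 k₀ hk₀D] at this
    exact hg0 this.symm
  have hle : ∀ k < D, (¬ ∀ᶠ t in 𝓝 0, a k t = 0) →
      analyticOrderNatAt (a k₀) 0 * (D - k) ≤ (D - k₀) * analyticOrderNatAt (a k) 0 := by
    intro k hk hkne
    have h1 := hmin k (Finset.mem_filter.2 ⟨Finset.mem_range.2 hk, hkne⟩)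
    have hk' : (0 : ℚ) < ((D - k : ℕ) : ℚ) := by exact_mod_cast (by omega : 0 < D - k)
    have hk₀' : (0 : ℚ) < ((D - k₀ : ℕ) : ℚ) := by exact_mod_cast (by omega : 0 < D - k₀)
    rw [div_le_div_iff₀ hk₀' hk'] at h1
    rw [mul_comm (D - k₀)]
    exact_mod_cast h1
  have hb : ∀ k, ∃ b : ℂ → ℂ, AnalyticAt ℂ b 0 ∧
      (k < D → ∀ᶠ s in 𝓝 0, a k (s ^ (D - k₀)) = s ^ (analyticOrderNatAt (a k₀) 0 * (D - k)) * b s) ∧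
      (k = k₀ → b 0 ≠ 0) ∧ ((∀ᶠ t in 𝓝 0, a k t = 0) → b 0 = 0) := by
    intro k
    have hpow : Tendsto (fun s : ℂ => s ^ (D - k₀)) (𝓝 0) (𝓝 0) :=
      (continuous_pow _).tendsto' _ _ (by simp [hv])
    by_cases hk : ∀ᶠ t in 𝓝 0, a k t = 0
    · refine ⟨0, analyticAt_const, fun _ => ?_, fun h => absurd (h ▸ hk) hk₀ne, fun _ => rfl⟩
      filter_upwards [hpow.eventually hk] with s hs
      simp [hs]
    · obtain ⟨g, hg, hg0, hag⟩ := hfac k hk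
      refine ⟨fun s => s ^ ((D - k₀) * analyticOrderNatAt (a k) 0 -
        analyticOrderNatAt (a k₀) 0 * (D - k)) * g (s ^ (D - k₀)), ?_, fun hkD => ?_, ?_,
        fun h => absurd h hk⟩
      · exact AnalyticAt.mul (by fun_prop) (hg.fun_comp_of_eq (by fun_prop) (by simp [hv]))
      · filter_upwards [hpow.eventually hag] with s hs
        rw [hs, ← mul_assoc, ← pow_add, ← pow_mul, Nat.add_sub_cancel' (hle k hkD hk)]
      · rintro rfl
        simp [mul_comm, hv, hg0]
  choose b hb1 hb2 hb3 hb4 using hb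
  exact ⟨_, _, b, hu, hv, hb1, hb2, ⟨k₀, hk₀D, hb3 k₀ rfl⟩, hb4⟩

lemma sum_newton_substitution {a b : ℕ → ℂ} {D u : ℕ} {s : ℂ}
    (h : ∀ k < D, a k = s ^ (u * (D - k)) * b k) (w e : ℂ) :
    ∑ k ∈ Finset.range D, a k * (s ^ u * w) ^ k + (s ^ u * w) ^ D * e =
      s ^ (u * D) * (∑ k ∈ Finset.range D, b k * w ^ k + w ^ D * e) := by
  rw [mul_add, Finset.mul_sum]
  congr 1
  · refine Finset.sum_congr rfl fun k hk => ?_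
    have hk' := Finset.mem_range.1 hk
    obtain ⟨j, rfl⟩ := Nat.exists_eq_add_of_le hk'.le
    rw [h k hk', Nat.add_sub_cancel_left]
    ring
  · ring

/-! ### Puiseux's theorem -/

/-- The Newton step. For `G` in Tschirnhaus normal form of order `d + 1`, the substitution
`t = s ^ v`, `z = s ^ u * w` with `u / v` the least Newton slope leads to functions whose zeros in
`w` have multiplicity at most `d` at `s = 0`. -/
lemma HasPuiseuxCover.of_normal_form {G : ℂ × ℂ → ℂ} {d : ℕ} {a : ℕ → ℂ → ℂ} {E : ℂ × ℂ → ℂ}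
    (ih : ∀ m < d + 1, ∀ H : ℂ × ℂ → ℂ, AnalyticAt ℂ H 0 →
      analyticOrderAt (fun z => H (0, z)) 0 = (m : ℕ) → HasPuiseuxCover H)
    (ha : ∀ k, AnalyticAt ℂ (a k) 0) (ha0 : ∀ k < d + 1, a k 0 = 0)
    (had : ∀ᶠ t in 𝓝 0, a d t = 0) (hE : AnalyticAt ℂ E 0) (hE0 : E 0 ≠ 0)
    (hG : ∀ᶠ x in 𝓝 (0 : ℂ × ℂ), G x =
      ∑ k ∈ Finset.range (d + 1), a k x.1 * x.2 ^ k + x.2 ^ (d + 1) * E x) :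
    HasPuiseuxCover G := by
  have hfst : Tendsto (fun x : ℂ × ℂ => x.1) (𝓝 0) (𝓝 0) := continuous_fst.tendsto' _ _ rfl
  by_cases hne : ∃ k < d + 1, ¬ ∀ᶠ t in 𝓝 0, a k t = 0
  swap
  · -- all coefficients vanish, so `G = z ^ (d + 1) * E` and the only zero is `z = 0`
    push Not at hne
    have hall : ∀ᶠ t in 𝓝 (0 : ℂ), ∀ k ∈ Finset.range (d + 1), a k t = 0 :=
      (Finset.eventually_all _).2 fun k hk => by simpa using hne k (Finset.mem_range.1 hk)
    refine ⟨{(1, 0)}, Set.finite_singleton _, ?_, ?_⟩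
    · rintro _ rfl
      refine ⟨le_rfl, analyticAt_const, rfl, ?_⟩
      have hs : Tendsto (fun s : ℂ => (s, (0 : ℂ))) (𝓝 0) (𝓝 0) :=
        (by fun_prop : Continuous fun t : ℂ => (t, (0 : ℂ))).tendsto' _ _ rfl
      filter_upwards [hs.eventually hG, hall] with s h1 h2
      simp only [pow_one, Pi.zero_apply]
      rw [h1, Finset.sum_eq_zero fun k hk => by simp [h2 k hk]]
      simp
    · filter_upwards [hG, hfst.eventually hall, hE.continuousAt.eventually_ne hE0] with x h1 h2 h3 h4
      rw [h1, Finset.sum_eq_zero fun k hk => by simp [h2 k hk], zero_add] at h4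
      exact ⟨_, rfl, x.1, by simp, (pow_eq_zero_iff d.succ_ne_zero).1
        ((mul_eq_zero.1 h4).resolve_right h3) |>.symm⟩
  obtain ⟨u, v, b, hu, hv, hb, hab, hbne, hbz⟩ := exists_newton_slope ha ha0 hne
  have hab' : ∀ᶠ s in 𝓝 (0 : ℂ), ∀ k ∈ Finset.range (d + 1),
      a k (s ^ v) = s ^ (u * (d + 1 - k)) * b k s :=
    (Finset.eventually_all _).2 fun k hk => hab k (Finset.mem_range.1 hk)
  let H : ℂ × ℂ → ℂ := fun x => ∑ k ∈ Finset.range (d + 1), b k x.1 * x.2 ^ k +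
    x.2 ^ (d + 1) * E (x.1 ^ v, x.1 ^ u * x.2)
  have hsub : ∀ w₀ : ℂ, Tendsto (fun x : ℂ × ℂ => (x.1 ^ v, x.1 ^ u * x.2)) (𝓝 (0, w₀)) (𝓝 0) :=
    fun w₀ => (by fun_prop : Continuous fun x : ℂ × ℂ => (x.1 ^ v, x.1 ^ u * x.2)).tendsto' _ _
      (by simp [hu, hv])
  have hfst' : ∀ w₀ : ℂ, Tendsto (fun x : ℂ × ℂ => x.1) (𝓝 (0, w₀)) (𝓝 0) :=
    fun w₀ => continuous_fst.tendsto' _ _ rfl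
  have hHan : ∀ w₀ : ℂ, AnalyticAt ℂ H (0, w₀) := by
    intro w₀
    refine AnalyticAt.add (Finset.analyticAt_fun_sum _ fun k _ => ?_) ?_
    · have : AnalyticAt ℂ (fun x : ℂ × ℂ => b k x.1) (0, w₀) :=
        (hb k).fun_comp_of_eq (f := fun x : ℂ × ℂ => x.1) analyticAt_fst rfl
      exact this.mul (analyticAt_snd.pow k)
    · refine (analyticAt_snd.pow _).mul (hE.fun_comp_of_eq
        (f := fun x : ℂ × ℂ => (x.1 ^ v, x.1 ^ u * x.2)) ?_ (by simp [hu, hv]))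
      exact (analyticAt_fst.pow v).prod ((analyticAt_fst.pow u).mul analyticAt_snd)
  have hrel : ∀ w₀ : ℂ, ∀ᶠ x in 𝓝 ((0 : ℂ), w₀),
      G (x.1 ^ v, x.1 ^ u * x.2) = x.1 ^ (u * (d + 1)) * H x := by
    intro w₀
    filter_upwards [(hsub w₀).eventually hG, (hfst' w₀).eventually hab'] with x h1 h2
    rw [h1]
    exact sum_newton_substitution (a := fun k => a k (x.1 ^ v)) (b := fun k => b k x.1)
      (fun k hk => h2 k (Finset.mem_range.2 hk)) _ _
  -- the polynomial `H (0, ·)`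
  let Q : Polynomial ℂ := ∑ k ∈ Finset.range (d + 1), Polynomial.monomial k (b k 0) +
    Polynomial.monomial (d + 1) (E 0)
  have hQeval : ∀ w, Q.eval w = H (0, w) := fun w => by
    simp [Q, H, Polynomial.eval_finsetSum, hu, hv, mul_comm (E 0), ← Prod.zero_eq_mk]
  have hQcoeff : ∀ k < d + 1, Q.coeff k = b k 0 := fun k hk => by
    simp [Q, Polynomial.coeff_monomial, hk.ne', Finset.sum_ite_eq', hk]
  have hQtop : Q.coeff (d + 1) = E 0 := by
    simp [Q, Polynomial.coeff_monomial]
  have hQdeg : Q.natDegree = d + 1 := by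
    refine le_antisymm ?_ (Polynomial.le_natDegree_of_ne_zero (by rwa [hQtop]))
    refine Polynomial.natDegree_add_le_of_degree_le
      (Polynomial.natDegree_sum_le_of_forall_le _ _ fun k hk => ?_)
      (Polynomial.natDegree_monomial_le _)
    exact (Polynomial.natDegree_monomial_le _).trans (Finset.mem_range.1 hk).le
  have hQ0 : Q ≠ 0 := by rintro h; simp [h] at hQdeg
  obtain ⟨w₁, hw₁⟩ := IsAlgClosed.exists_root Q (by
    rw [Polynomial.degree_eq_natDegree hQ0, hQdeg]; exact_mod_cast d.succ_ne_zero)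
  have hroot : ∀ w ∈ {w | H (0, w) = 0}, HasPuiseuxCover fun x => H (x.1, x.2 + w) := by
    intro w hw
    have hlt := Polynomial.analyticOrderAt_eval_add_lt hQdeg
      (by rw [hQcoeff d d.lt_succ_self]; exact hbz d had)
      (by obtain ⟨k, hk, hk0⟩ := hbne; exact ⟨k, hk, by rwa [hQcoeff k hk]⟩) w
    simp only [hQeval] at hlt
    obtain ⟨m, hm⟩ := ENat.ne_top_iff_exists.1 hlt.ne_top
    rw [← hm] at hlt
    refine ih m (by exact_mod_cast hlt) _ ?_ hm.symm
    exact (hHan w).fun_comp_of_eq (f := fun x : ℂ × ℂ => (x.1, x.2 + w))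
      (analyticAt_fst.prod (analyticAt_snd.add analyticAt_const)) (by simp)
  have hfin : {w | H (0, w) = 0}.Finite := by
    refine (Q.finite_setOfPred_isRoot hQ0).subset fun w hw => ?_
    rw [Set.mem_ofPred_eq, Polynomial.IsRoot.def, hQeval]; exact hw
  choose! B hBfin hBbr hBcov using hroot
  let C : Set (ℕ × (ℂ → ℂ)) := ⋃ w ∈ {w | H (0, w) = 0},
    (fun b : ℕ × (ℂ → ℂ) => (b.1 * v, fun σ => (σ ^ b.1) ^ u * (b.2 σ + w))) '' B w
  -- the zeros of `H` near `(0, w₀)` lie on the branches collected in `C`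
  have hlocal : ∀ w₀ : ℂ, ∀ᶠ x in 𝓝 ((0 : ℂ), w₀), H x = 0 →
      ∃ c ∈ C, ∃ σ, σ ^ c.1 = x.1 ^ v ∧ c.2 σ = x.1 ^ u * x.2 := by
    intro w₀
    by_cases hw : H (0, w₀) = 0
    · have ht : Tendsto (fun x : ℂ × ℂ => (x.1, x.2 - w₀)) (𝓝 (0, w₀)) (𝓝 0) :=
        (by fun_prop : Continuous fun x : ℂ × ℂ => (x.1, x.2 - w₀)).tendsto' _ _ (by simp)
      filter_upwards [ht.eventually (hBcov w₀ hw)] with x hx hHx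
      obtain ⟨b, hb, σ, h1, h2⟩ := hx (by simpa using hHx)
      refine ⟨_, Set.mem_biUnion hw ⟨b, hb, rfl⟩, σ, ?_, ?_⟩
      · simp only at h1 ⊢
        rw [pow_mul, h1]
      · simp only at h1 h2 ⊢
        rw [h1, h2, sub_add_cancel]
    · filter_upwards [(hHan w₀).continuousAt.eventually_ne hw] with x hx h0
      exact absurd h0 hx
  refine ⟨C, hfin.biUnion fun w hw => (hBfin w hw).image _, ?_, ?_⟩
  · intro c hc
    obtain ⟨w, hw, b, hb, rfl⟩ := Set.mem_iUnion₂.1 hc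
    obtain ⟨h1, h2, h3, h4⟩ := hBbr w hw b hb
    have hb0 : b.1 ≠ 0 := by omega
    refine ⟨Nat.one_le_iff_ne_zero.2 (mul_ne_zero hb0 hv),
      AnalyticAt.mul (by fun_prop) (h2.add analyticAt_const), by simp [hb0, hu], ?_⟩
    have ht : Tendsto (fun σ : ℂ => (σ ^ b.1, b.2 σ + w)) (𝓝 0) (𝓝 (0, w)) := by
      have : ContinuousAt (fun σ : ℂ => (σ ^ b.1, b.2 σ + w)) 0 :=
        (continuousAt_id.pow b.1).prodMk (h2.continuousAt.add continuousAt_const)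
      convert! this.tendsto using 2
      simp [hb0, h3]
    filter_upwards [ht.eventually (hrel w), h4] with σ h5 h6
    rw [pow_mul]
    exact h5.trans (by rw [h6, mul_zero])
  · -- the rescaled variable `w` stays bounded on the zero set, so compactness applies
    let M : ℝ := ∑ k ∈ Finset.range (d + 1), (‖b k 0‖ + 1)
    have hbM : ∀ᶠ s in 𝓝 (0 : ℂ), ∀ k ∈ Finset.range (d + 1), ‖b k s‖ ≤ M := by
      refine (Finset.eventually_all _).2 fun k hk => ?_
      have h1 : ‖b k 0‖ < M := by
        have := Finset.single_le_sum (f := fun k => ‖b k 0‖ + 1) (fun _ _ => by positivity) hk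
        simp only [M]; linarith
      filter_upwards [(hb k).continuousAt.norm.eventually_lt_const h1] with s hs using hs.le
    have hε : 0 < ‖E 0‖ / 2 := by positivity
    have hEε : ∀ᶠ x in 𝓝 (0 : ℂ × ℂ), ‖E 0‖ / 2 ≤ ‖E x‖ := by
      filter_upwards [hE.continuousAt.norm.eventually_const_lt
        (half_lt_self (norm_pos_iff.2 hE0))] with x hx using hx.le
    have hcomp := (isCompact_closedBall (0 : ℂ)
      (max 1 ((d + 1 : ℕ) * M / (‖E 0‖ / 2)))).eventually_forall_of_forall_eventually
        (P := fun s w => H (s, w) = 0 → ∃ c ∈ C, ∃ σ, σ ^ c.1 = s ^ v ∧ c.2 σ = s ^ u * w)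
        fun w _ => hlocal w
    filter_upwards [hG, hEε, hfst.eventually (eventually_forall_pow_eq hab' v),
      hfst.eventually (eventually_forall_pow_eq hbM v),
      hfst.eventually (eventually_forall_pow_eq hcomp v)] with ⟨t, z⟩ hGx hEx habx hbx hcx h0
    simp only at *
    rw [h0] at hGx
    obtain ⟨s, hs⟩ := IsAlgClosed.exists_pow_nat_eq t (Nat.pos_of_ne_zero hv)
    rcases eq_or_ne t 0 with rfl | ht
    · have hz : z = 0 := by
        rw [Finset.sum_eq_zero fun k hk => by rw [ha0 k (Finset.mem_range.1 hk), zero_mul],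
          zero_add] at hGx
        have : E (0, z) ≠ 0 := norm_pos_iff.1 (hε.trans_le hEx)
        simpa [this] using hGx.symm
      obtain ⟨c, hc, σ, h1, h2⟩ := (hlocal w₁).self_of_nhds (by rw [← hQeval]; exact hw₁)
      exact ⟨c, hc, σ, by simpa [hv] using h1, by simpa [hu, hz] using h2⟩
    · have hs0 : s ≠ 0 := by rintro rfl; simp [hv] at hs; exact ht hs.symm
      have hsu : s ^ u * (z / s ^ u) = z := by field_simp
      have hH0 : ∑ k ∈ Finset.range (d + 1), b k s * (z / s ^ u) ^ k +
          (z / s ^ u) ^ (d + 1) * E (t, z) = 0 := by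
        have h1 := sum_newton_substitution (a := fun k => a k t) (b := fun k => b k s) (D := d + 1)
          (u := u) (s := s) (fun k hk => by rw [← habx s hs k (Finset.mem_range.2 hk), hs])
          (z / s ^ u) (E (t, z))
        rw [hsu, ← hGx] at h1
        exact (mul_eq_zero.1 h1.symm).resolve_left (pow_ne_zero _ hs0)
      have hbd := norm_le_of_sum_eq_zero hε hEx (b := fun k => b k s)
        (fun k hk => hbx s hs k (Finset.mem_range.2 hk)) hH0
      obtain ⟨c, hc, σ, h1, h2⟩ := hcx s hs (z / s ^ u) (by simpa using hbd) (by
        simp only [H, hs, hsu]; exact hH0)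
      exact ⟨c, hc, σ, by rw [h1, hs], by rw [h2, hsu]⟩

/-- Puiseux's theorem: the zero set of an analytic function `G` with `G (0, ·)` not identically
zero is covered near the origin by finitely many Puiseux branches. -/
theorem hasPuiseuxCover {G : ℂ × ℂ → ℂ} (hG : AnalyticAt ℂ G 0)
    (hne : ¬ ∀ᶠ z in 𝓝 0, G (0, z) = 0) : HasPuiseuxCover G := by
  obtain ⟨m, hm⟩ := ENat.ne_top_iff_exists.1 fun h => hne (analyticOrderAt_eq_top.1 h)
  clear hne
  induction m using Nat.strong_induction_on generalizing G with
  | _ m ih =>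
    rcases m with _ | d
    · have hG0 : G 0 ≠ 0 := by
        have h1 : AnalyticAt ℂ (fun z => G (0, z)) 0 := hG.fun_comp_of_eq
          (f := fun z : ℂ => ((0 : ℂ), z)) (analyticAt_const.prod analyticAt_id) rfl
        exact h1.analyticOrderAt_eq_zero.1 hm.symm
      refine ⟨∅, Set.finite_empty, by simp, ?_⟩
      filter_upwards [hG.continuousAt.eventually_ne hG0] with x hx h0
      exact absurd h0 hx
    · obtain ⟨h, a, E, hh, hh0, ha, ha0, had, hE, hE0, hexp⟩ := exists_tschirnhaus hG hm.symm
      exact .of_translate hh hh0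
        (.of_normal_form (fun m hm H hH hH' => ih m hm hH hH'.symm) ha ha0 had hE hE0 hexp)

/-- Replacing a branch `g` by all its conjugates `s ↦ g (ζ * s)`, `ζ ^ n = 1`, the covering is
obtained with the principal value of `t ^ (1 / n)`. -/
lemma HasPuiseuxCover.exists_principal {G : ℂ × ℂ → ℂ} (hG : HasPuiseuxCover G) :
    ∃ B : Set (ℕ × (ℂ → ℂ)), B.Finite ∧ (∀ b ∈ B, IsPuiseuxBranch G b) ∧
      ∀ᶠ x in 𝓝 (0 : ℂ × ℂ), G x = 0 → ∃ b ∈ B, b.2 (x.1 ^ (1 / (b.1 : ℂ))) = x.2 := by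
  obtain ⟨B, hB, hbr, hcov⟩ := hG
  refine ⟨⋃ b ∈ B, (fun ζ : ℂ => (b.1, fun s => b.2 (ζ * s))) '' {ζ | ζ ^ b.1 = 1},
    hB.biUnion fun b hb => Set.Finite.image _ ?_, ?_, ?_⟩
  · refine (Polynomial.nthRootsFinset b.1 (1 : ℂ)).finite_toSet.subset fun ζ hζ => ?_
    exact (Polynomial.mem_nthRootsFinset (hbr b hb).1 _).2 hζ
  · intro c hc
    obtain ⟨b, hb, ζ, hζ, rfl⟩ := Set.mem_iUnion₂.1 hc
    obtain ⟨h1, h2, h3, h4⟩ := hbr b hb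
    refine ⟨h1, h2.fun_comp_of_eq (by fun_prop) (by simp), by simp [h3], ?_⟩
    have ht : Tendsto (fun s : ℂ => ζ * s) (𝓝 0) (𝓝 0) :=
      (by fun_prop : Continuous fun s : ℂ => ζ * s).tendsto' _ _ (by simp)
    filter_upwards [ht.eventually h4] with s hs
    rwa [mul_pow, show ζ ^ b.1 = 1 from hζ, one_mul] at hs
  · filter_upwards [hcov] with x hx h0
    obtain ⟨b, hb, s, h1, h2⟩ := hx h0
    have hb0 : b.1 ≠ 0 := by have := (hbr b hb).1; omega
    have hρ : (x.1 ^ (1 / (b.1 : ℂ))) ^ b.1 = x.1 := by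
      rw [one_div, Complex.cpow_nat_inv_pow _ hb0]
    set ρ := x.1 ^ (1 / (b.1 : ℂ)) with hρdef
    obtain ⟨ζ, hζ, hζs⟩ : ∃ ζ : ℂ, ζ ^ b.1 = 1 ∧ ζ * ρ = s := by
      rcases eq_or_ne ρ 0 with h | h
      · refine ⟨1, one_pow _, ?_⟩
        rw [← hρ, h, zero_pow hb0] at h1
        rw [h, mul_zero, pow_eq_zero_iff hb0 |>.1 h1]
      · refine ⟨s / ρ, ?_, div_mul_cancel₀ _ h⟩
        rw [div_pow, h1, hρ, div_self]
        rw [← hρ]; exact pow_ne_zero _ h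
    refine ⟨_, Set.mem_biUnion hb ⟨ζ, hζ, rfl⟩, ?_⟩
    change b.2 (ζ * ρ) = x.2
    rw [hζs, h2]

/-! ### Functions of a real and a complex variable -/

/-- The expansion of `f` at a point also converges for complex increments of the real variable. -/
lemma IsAnalyticRealComplexOn.exists_complexification {f : ℝ × ℂ → ℂ} {A : Set (ℝ × ℂ)}
    (hf : IsAnalyticRealComplexOn f A) {t₀ : ℝ} {z₀ : ℂ} (h₀ : (t₀, z₀) ∈ A) :
    ∃ (F : ℂ × ℂ → ℂ) (a : ℕ → ℕ → ℂ) (r : ℝ), 0 < r ∧ HasDoubleSeries F a r ∧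
      ∀ᶠ x in 𝓝 (t₀, z₀), f x = F (((x.1 - t₀ : ℝ) : ℂ), x.2 - z₀) := by
  obtain ⟨a, r, hr, h⟩ := hf t₀ z₀ h₀
  have hF : HasDoubleSeries (fun x => ∑' k : ℕ × ℕ, a k.1 k.2 * x.1 ^ k.1 * x.2 ^ k.2) a r := by
    intro t z ht hz
    have h1 := (h (t₀ + ‖t‖) (z₀ + z) (by simpa using ht) (by simpa using hz)).summable.norm
    exact (Summable.of_norm (h1.congr fun k => by simp)).hasSum
  refine ⟨_, a, r, hr, hF, ?_⟩
  filter_upwards [Metric.ball_mem_nhds (t₀, z₀) hr] with x hx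
  rw [mem_ball_iff_norm, Prod.norm_def, max_lt_iff] at hx
  have h1 := h x.1 x.2 hx.1 hx.2
  exact h1.unique (hF _ _ (by rw [Complex.norm_real]; exact hx.1) hx.2)

lemma IsAnalyticRealComplexOn.analyticOnNhd {f : ℝ × ℂ → ℂ} {A : Set (ℝ × ℂ)}
    (hf : IsAnalyticRealComplexOn f A) : AnalyticOnNhd ℝ f A := by
  rintro ⟨t₀, z₀⟩ h₀
  obtain ⟨F, a, r, hr, hF, h⟩ := hf.exists_complexification h₀
  refine AnalyticAt.congr ?_ (EventuallyEq.symm h)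
  refine (hF.analyticAt hr).restrictScalars (𝕜 := ℝ) |>.fun_comp_of_eq ?_ (by simp)
  refine AnalyticAt.prod ?_ (analyticAt_snd.sub analyticAt_const)
  exact (Complex.ofRealCLM.analyticAt _).comp (analyticAt_fst.sub analyticAt_const)

/-- For all small `δ`, the parametrization of a Puiseux branch is analytic, satisfies the equation
and stays small on the whole disc `|s| < δ ^ (1 / n)`, which lies over `|t| < δ`. -/
lemma IsPuiseuxBranch.eventually {G : ℂ × ℂ → ℂ} {b : ℕ × (ℂ → ℂ)} (hb : IsPuiseuxBranch G b)
    {η : ℝ} (hη : 0 < η) :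
    ∀ᶠ δ : ℝ in 𝓝[>] 0, ∀ s ∈ Metric.ball (0 : ℂ) (δ ^ (1 / (b.1 : ℝ))),
      AnalyticAt ℂ b.2 s ∧ G (s ^ b.1, b.2 s) = 0 ∧ ‖b.2 s‖ < η := by
  obtain ⟨h1, h2, h3, h4⟩ := hb
  have h5 : ∀ᶠ s in 𝓝 (0 : ℂ), ‖b.2 s‖ < η :=
    h2.continuousAt.norm.eventually_lt_const (by simpa [h3] using hη)
  obtain ⟨ε, hε, h⟩ := Metric.eventually_nhds_iff_ball.1 (h2.eventually_analyticAt.and (h4.and h5))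
  have hn : (0 : ℝ) < 1 / (b.1 : ℝ) := by positivity
  have ht : Tendsto (fun δ : ℝ => δ ^ (1 / (b.1 : ℝ))) (𝓝[>] 0) (𝓝 0) := by
    have := (Real.continuousAt_rpow_const 0 (1 / (b.1 : ℝ)) (Or.inr hn.le)).tendsto
    rw [Real.zero_rpow hn.ne'] at this
    exact this.mono_left nhdsWithin_le_nhds
  filter_upwards [ht.eventually_lt_const hε] with δ hδ s hs
  exact h s (Metric.ball_subset_ball hδ.le hs)

theorem lemma1 (A : Set (ℝ × ℂ)) (hAopen : IsOpen A) (hAconn : IsConnected A)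
    (p : ℂ) (hpA : ((0 : ℝ), p) ∈ A)
    (f : ℝ × ℂ → ℂ) (hf : IsAnalyticRealComplexOn f A) (hfp : f (0, p) = 0)
    (hnc : ∀ᶠ t : ℝ in 𝓝[>] 0, ¬ ∃ w : ℂ, ∀ z : ℂ, (t, z) ∈ A → f (t, z) = w) :
    ∃ V : Set (ℝ × ℂ), IsOpen V ∧ ((0 : ℝ), p) ∈ V ∧ V ⊆ A ∧
      ∃ δ : ℝ, 0 < δ ∧ (∀ x ∈ V, |x.1| < δ) ∧
        ∃ (N : ℕ) (c : Fin N → ℝ → ℂ),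
          (∀ i, IsAnalyticInRationalPower (c i) δ ∧ c i 0 = p) ∧
          (∀ i, ∀ t : ℝ, |t| < δ → (t, c i t) ∈ A ∧ f (t, c i t) = 0) ∧
          (∀ t : ℝ, ∀ z : ℂ, (t, z) ∈ V → f (t, z) = 0 →
            (t ≠ 0 ∨ ¬ ∀ᶠ w in 𝓝 p, f (0, w) = 0) → ∃ i, z = c i t) := by
  obtain ⟨F, a, r, hr, hF, hfF⟩ := hf.exists_complexification hpA
  have hcx : Tendsto (fun x : ℝ × ℂ => (((x.1 - 0 : ℝ) : ℂ), x.2 - p)) (𝓝 (0, p)) (𝓝 0) :=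
    (by fun_prop : Continuous fun x : ℝ × ℂ => (((x.1 - 0 : ℝ) : ℂ), x.2 - p)).tendsto' _ _
      (by simp)
  -- `F` is not identically zero: otherwise `f` would vanish on all of the connected set `A`
  have hFne : ¬ ∀ᶠ x in 𝓝 (0 : ℂ × ℂ), F x = 0 := by
    intro h0
    have h1 : f =ᶠ[𝓝 (0, p)] 0 := by
      filter_upwards [hfF, hcx.eventually h0] with x h1 h2
      rw [h1, h2, Pi.zero_apply]
    have h2 := hf.analyticOnNhd.eqOn_zero_of_preconnected_of_eventuallyEq_zero
      hAconn.isPreconnected hpA h1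
    obtain ⟨t, ht⟩ := hnc.exists
    exact ht ⟨0, fun z hz => h2 hz⟩
  obtain ⟨m, G, hG, hGne, hFG⟩ := hF.exists_eq_pow_mul hr hFne
  obtain ⟨B, hB, hbr, hcov⟩ := (hasPuiseuxCover hG hGne).exists_principal
  have hnear : ∀ᶠ x in 𝓝 ((0 : ℝ), p), x ∈ A ∧ f x = (x.1 : ℂ) ^ m * G (x.1, x.2 - p) ∧
      (G (x.1, x.2 - p) = 0 → ∃ b ∈ B, b.2 ((x.1 : ℂ) ^ (1 / (b.1 : ℂ))) = x.2 - p) := by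
    filter_upwards [hAopen.mem_nhds hpA, hfF, hcx.eventually hFG, hcx.eventually hcov]
      with x h1 h2 h3 h4
    simp only [sub_zero] at h2 h3 h4
    exact ⟨h1, by rw [h2, h3], h4⟩
  obtain ⟨η, hη, hball⟩ := Metric.eventually_nhds_iff_ball.1 hnear
  replace hball : ∀ (t : ℝ) (z : ℂ), |t| < η → ‖z - p‖ < η → _ := fun t z ht hz =>
    hball (t, z) (by
      rw [mem_ball_iff_norm, Prod.norm_def, max_lt_iff]
      exact ⟨by simpa using ht, hz⟩)
  obtain ⟨δ, hδbr, hδη, hδ⟩ := (((hB.eventually_all).2 fun b hb =>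
    (hbr b hb).eventually hη).and ((eventually_nhdsWithin_of_eventually_nhds
      (eventually_lt_nhds hη)).and self_mem_nhdsWithin)).exists
  have : Finite B := hB.to_subtype
  let e := (Finite.equivFin B).symm
  refine ⟨{x | |x.1| < δ ∧ ‖x.2 - p‖ < η}, ?_, by simp [hδ, hη], fun x hx =>
    (hball x.1 x.2 (hx.1.trans hδη) hx.2).1, δ, hδ, fun x hx => hx.1, Nat.card B,
    fun i t => p + (e i).1.2 ((t : ℂ) ^ (1 / ((e i).1.1 : ℂ))), fun i => ?_, fun i t ht => ?_,
    fun t z hV h0 hor => ?_⟩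
  · have h1 : Continuous fun x : ℝ × ℂ => |x.1| := by fun_prop
    have h2 : Continuous fun x : ℝ × ℂ => ‖x.2 - p‖ := by fun_prop
    exact (isOpen_lt h1 continuous_const).inter (isOpen_lt h2 continuous_const)
  · obtain ⟨h1, -, h3, -⟩ := hbr _ (e i).2
    refine ⟨⟨_, h1, fun s => p + (e i).1.2 s, fun s hs => ?_, fun t _ => rfl⟩, ?_⟩
    · exact analyticAt_const.add (hδbr _ (e i).2 s hs).1
    · have hn : (1 / ((e i).1.1 : ℂ)) ≠ 0 := by
        rw [one_div]; exact inv_ne_zero (by exact_mod_cast (by omega : (e i).1.1 ≠ 0))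
      simp only [Complex.ofReal_zero, Complex.zero_cpow hn, h3, add_zero]
  · have hn : (e i).1.1 ≠ 0 := by have := (hbr _ (e i).2).1; omega
    set n := (e i).1.1
    set s := (t : ℂ) ^ (1 / (n : ℂ))
    have hs : s ^ n = t := by simp only [s]; rw [one_div, Complex.cpow_nat_inv_pow _ hn]
    have hsball : s ∈ Metric.ball (0 : ℂ) (δ ^ (1 / (n : ℝ))) := by
      rw [mem_ball_zero_iff]
      refine lt_of_pow_lt_pow_left₀ n (by positivity) ?_
      rw [← norm_pow, hs, Complex.norm_real, one_div, Real.rpow_inv_natCast_pow hδ.le hn]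
      exact ht
    obtain ⟨-, h2, h3⟩ := hδbr _ (e i).2 s hsball
    obtain ⟨h4, h5, -⟩ := hball t (p + (e i).1.2 s) (ht.trans hδη) (by simpa using h3)
    refine ⟨h4, ?_⟩
    rw [h5, add_sub_cancel_left, ← hs, h2, mul_zero]
  · obtain ⟨-, h2, h3⟩ := hball t z (hV.1.trans hδη) hV.2
    have hG0 : G (t, z - p) = 0 := by
      rw [h0] at h2
      refine (mul_eq_zero.1 h2.symm).resolve_left fun hpow => ?_
      obtain ⟨ht, hm⟩ := pow_eq_zero_iff'.1 hpow
      -- at `t = 0` a positive power of `t` would make `f (0, ·)` vanish near `p`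
      refine hor.resolve_left (fun h => h (by simpa using ht)) ?_
      filter_upwards [Metric.ball_mem_nhds p hη] with w hw
      rw [(hball 0 w (by simpa using hη) (mem_ball_iff_norm.1 hw)).2.1]
      simp [hm]
    obtain ⟨b, hb, hbz⟩ := h3 hG0
    refine ⟨e.symm ⟨b, hb⟩, ?_⟩
    simp only [Equiv.apply_symm_apply] at hbz ⊢
    rw [hbz]; ring
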